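/- Let $\mathbb{D}$ be the open unit disk, let $K\ge 1$ and put $k=\frac{K-1}{K+1}$. Let $\mathcal{S}^*$ be the class of analytic functions $f(z)=z+\sum_{m\ge2}a_mz^m$ on $\mathbb{D}$ such that $zf'(z)/f(z)$ is subordinate to $(1+z)/(1-z)$. (For functions on $\mathbb{D}$, $u$ is subordinate to $v$, written $u\prec v$, if $u=v\circ w$ for an analytic $w:\mathbb{D}\to\mathbb{D}$ with $w(0)=0$.) Put $$r_0=\frac{5K+1-\sqrt{8K(3K+1)}}{K+1}.$$ Then $0<r_0<\frac13$, and the following hold. (i) Let $h=f+\overline{g}$ be a sense-preserving $K$-quasiconformal harmonic mapping of $\mathbb{D}$, with $f\in\mathcal{S}^*$, $g$ analytic in $\mathbb{D}$ and $g(0)=0$, and let $h_1=f_1+\overline{g_1}\prec h$, where $f_1(z)=\sum_{m\ge1}c_mz^m$ and $g_1(z)=\sum_{m\ge1}d_mz^m$ are analytic in $\mathbb{D}$. Then $$\sum_{m=1}^{\infty}(|c_m|+|d_m|)\,r^m\le d\bigl(f(0),\partial f(\mathbb{D})\bigr)\qquad\text{for all } 0\le r\le r_0,$$ where $d$ is the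 Euclidean distance. It is not needed here that $h$ be injective: it suffices that $|g'|<|f'|$ and $|f'|+|g'|\le K(|f'|-|g'|)$ on $\mathbb{D}$. (ii) The radius $r_0$ is sharp: with $f_0(z)=z/(1-z)^2\in\mathcal{S}^*$, the function $p=f_0+k\overline{f_0}$ is a sense-preserving $K$-quasiconformal harmonic mapping (a homeomorphism of $\mathbb{D}$ onto its open image), and for $h=h_1=p$ equality holds in the above inequality at $r=r_0$, while the inequality fails for every $r$ with $r_0<r<1$. -/

import Mathlib

open Metric Set
open scoped ComplexConjugate

noncomputable section

/-- The open unit disk `𝔻`. -/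
def unitDisk : Set ℂ := ball (0 : ℂ) 1

/-- The `m`-th Taylor coefficient of `f` at the origin. -/
def taylorCoeff (f : ℂ → ℂ) (m : ℕ) : ℂ := iteratedDeriv m f 0 / (m.factorial : ℂ)

/-- A Schwarz function: an analytic self-map of the unit disk that fixes the origin. -/
structure IsSchwarz (w : ℂ → ℂ) : Prop where
  analytic : DifferentiableOn ℂ w unitDisk
  mapsTo : MapsTo w unitDisk unitDisk
  map_zero : w 0 = 0

/-- Subordination `u ≺ v` on the unit disk (for analytic or harmonic `u`, `v`):
`u = v ∘ w` for some Schwarz function `w`. -/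
def Subordinate (u v : ℂ → ℂ) : Prop :=
  ∃ w : ℂ → ℂ, IsSchwarz w ∧ ∀ z ∈ unitDisk, u z = v (w z)

/-- The class `𝒜` of analytic functions `f(z) = z + ∑_{m ≥ 2} a_m z^m` on the unit disk. -/
def classA : Set (ℂ → ℂ) :=
  {f | DifferentiableOn ℂ f unitDisk ∧ f 0 = 0 ∧ deriv f 0 = 1}

/-- The function `z f'(z) / f(z)`, with its removable singularity at the origin filled in
(for `f ∈ 𝒜` the value there is `1`). -/
def starlikeQuotient (f : ℂ → ℂ) (z : ℂ) : ℂ :=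
  if z = 0 then 1 else z * deriv f z / f z

/-- The Ma-Minda class `𝒮*(ψ)`: those `f ∈ 𝒜` with `z f'(z) / f(z) ≺ ψ(z)`. The requirement that
`f` has no zero other than the origin says that the quotient is a genuine function on the disk. -/
def maMindaStarlike (ψ : ℂ → ℂ) : Set (ℂ → ℂ) :=
  {f | f ∈ classA ∧ (∀ z ∈ unitDisk, z ≠ 0 → f z ≠ 0) ∧ Subordinate (starlikeQuotient f) ψ}

/-- The classical class `𝒮*` of starlike functions: `𝒮*(ψ)` with `ψ(z) = (1 + z) / (1 - z)`. -/
def starlikeClass : Set (ℂ → ℂ) := maMindaStarlike fun z => (1 + z) / (1 - z)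

/-- The harmonic function `f + conj g`. -/
def harmonicMap (f g : ℂ → ℂ) (z : ℂ) : ℂ := f z + conj (g z)

/-- `h = f + conj g`, with `f`, `g` analytic on the disk and `g 0 = 0`, is sense-preserving and
has maximal dilatation at most `K`. Here `∂h/∂z = f'` and `∂h/∂z̄ = conj g'`, so the Jacobian is
`|f'|² - |g'|²`, and the last field is `(|h_z| + |h_z̄|) / (|h_z| - |h_z̄|) ≤ K`, that is,
`|g' / f'| ≤ (K - 1) / (K + 1)`. Global injectivity is not required. -/
structure IsSensePreservingDilatationLE (K : ℝ) (f g : ℂ → ℂ) : Prop where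
  analytic_left : DifferentiableOn ℂ f unitDisk
  analytic_right : DifferentiableOn ℂ g unitDisk
  right_zero : g 0 = 0
  sense_preserving : ∀ z ∈ unitDisk, ‖deriv g z‖ < ‖deriv f z‖
  dilatation_le : ∀ z ∈ unitDisk,
    ‖deriv f z‖ + ‖deriv g z‖ ≤ K * (‖deriv f z‖ - ‖deriv g z‖)

/-- `h = f + conj g` is a sense-preserving `K`-quasiconformal harmonic mapping of the disk: in
addition to the dilatation bound, `h` is a homeomorphism of the disk onto an open set. -/
structure IsQuasiconformalHarmonic (K : ℝ) (f g : ℂ → ℂ) : Prop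
    extends IsSensePreservingDilatationLE K f g where
  homeo : Topology.IsOpenEmbedding (fun z : unitDisk => harmonicMap f g z)

/-- `h₁ = f₁ + conj g₁` (with `f₁`, `g₁` analytic on the disk and `g₁ 0 = 0`) belongs to the class
of harmonic functions subordinate to `h = f + conj g`. -/
structure IsHarmonicSubordinate (f₁ g₁ f g : ℂ → ℂ) : Prop where
  analytic_left : DifferentiableOn ℂ f₁ unitDisk
  analytic_right : DifferentiableOn ℂ g₁ unitDisk
  right_zero : g₁ 0 = 0
  subordinate : Subordinate (harmonicMap f₁ g₁) (harmonicMap f g)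

/-- The term of index `m` of `∑_{m ≥ 1} (|c_m| + |d_m|) r^m` is the value at `m - 1` of this
sequence, where `c_m`, `d_m` are the Taylor coefficients of `f₁`, `g₁`. -/
def bohrTerm (f₁ g₁ : ℂ → ℂ) (r : ℝ) (n : ℕ) : ℝ :=
  (‖taylorCoeff f₁ (n + 1)‖ + ‖taylorCoeff g₁ (n + 1)‖) * r ^ (n + 1)

/-- The Euclidean distance `d(f(0), ∂f(𝔻))`. -/
def boundaryDist (f : ℂ → ℂ) : ℝ := infDist (f 0) (frontier (f '' unitDisk))

/-- The radius `r₀ = (5K + 1 - √(8K(3K + 1))) / (K + 1)`. -/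
def bohrRadius (K : ℝ) : ℝ := (5 * K + 1 - √(8 * K * (3 * K + 1))) / (K + 1)

/-- The Koebe function `z / (1 - z)²`. -/
def koebe (z : ℂ) : ℂ := z / (1 - z) ^ 2

/-- `k` times the Koebe function, where `k = (K - 1) / (K + 1)`. -/
def scaledKoebe (K : ℝ) (z : ℂ) : ℂ := (((K - 1) / (K + 1) : ℝ) : ℂ) * koebe z

end

/-!
For the Bohr inequality, compare majorants `∑ |a_m| r^m`. If `φ` is analytic and bounded by `C` on
the disk, Carathéodory's estimate applied to `C - u φ` (`u` a unimodular constant) gives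
`|a_m| ≤ 2 (C - |φ 0|)` for `m ≥ 1`, so the majorant of `φ` is at most `C` for `r ≤ 1/3`. Applied
to the factor `w / z` in `f ∘ w - f 0 = z · (w / z) · ((f - f 0) / z) ∘ w`, this shows by
induction on the number of terms that composing with a Schwarz function does not increase
majorants; applied to the dilatation `ω = g' / f'`, it bounds the majorant of `g` by `k` times
that of `f`. A harmonic function determines its analytic and co-analytic parts up to constants, so
subordination acts on the two parts separately, and the Bohr sum is at most
`(1 + k) ∑ m r^m = (2K / (K + 1)) r / (1 - r)²` because starlike functions satisfy `|a_m| ≤ m`.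
This equals `1/4` exactly at `r = r₀`.

The boundary distance is at least `1/4`: writing `f z = z exp (L z)`, the lower bound
`Re (z f' / f) ≥ (1 - |z|) / (1 + |z|)` integrates along rays to the growth estimate
`|f z| ≥ |z| / (1 + |z|)²`, and `f` is univalent, so that its image is not all of `ℂ` and has a
boundary. The Koebe function attains equality in both the coefficient and the distance bounds.
-/

lemma zero_mem_unitDisk : (0 : ℂ) ∈ unitDisk := mem_ball_self one_pos

lemma mem_unitDisk_iff {z : ℂ} : z ∈ unitDisk ↔ ‖z‖ < 1 := mem_ball_zero_iff

lemma isOpen_unitDisk : IsOpen unitDisk := isOpen_ball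

lemma unitDisk_mem_nhds_zero : unitDisk ∈ nhds (0 : ℂ) :=
  isOpen_unitDisk.mem_nhds zero_mem_unitDisk

lemma one_sub_ne_zero_of_mem_unitDisk {z : ℂ} (hz : z ∈ unitDisk) : 1 - z ≠ 0 := fun h => by
  rw [mem_unitDisk_iff, ← sub_eq_zero.1 h, norm_one] at hz
  exact hz.false

section TaylorCoeff

open Finset.HasAntidiagonal (antidiagonal)

variable {f g : ℂ → ℂ}

lemma analyticAt_zero_of_differentiableOn (hf : DifferentiableOn ℂ f unitDisk) :
    AnalyticAt ℂ f 0 :=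
  hf.analyticAt unitDisk_mem_nhds_zero

lemma differentiableOn_dslope_zero (hf : DifferentiableOn ℂ f unitDisk) :
    DifferentiableOn ℂ (dslope f 0) unitDisk :=
  (Complex.differentiableOn_dslope unitDisk_mem_nhds_zero).2 hf

lemma eventuallyEq_zero_of_eqOn_unitDisk (h : EqOn f g unitDisk) : f =ᶠ[nhds 0] g :=
  Filter.eventuallyEq_of_mem unitDisk_mem_nhds_zero h

lemma taylorCoeff_zero (f : ℂ → ℂ) : taylorCoeff f 0 = f 0 := by simp [taylorCoeff]

lemma taylorCoeff_one (f : ℂ → ℂ) : taylorCoeff f 1 = deriv f 0 := by simp [taylorCoeff]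

lemma taylorCoeff_congr (h : f =ᶠ[nhds 0] g) (n : ℕ) : taylorCoeff f n = taylorCoeff g n := by
  simp only [taylorCoeff, (h.iteratedDeriv n).eq_of_nhds]

lemma taylorCoeff_eq_coeff {p : FormalMultilinearSeries ℂ ℂ ℂ} (hp : HasFPowerSeriesAt f p 0)
    (n : ℕ) : taylorCoeff f n = p.coeff n := by
  rw [hp.eq_formalMultilinearSeries hp.analyticAt.hasFPowerSeriesAt,
    FormalMultilinearSeries.coeff_ofScalars, taylorCoeff]

lemma taylorCoeff_dslope (hf : AnalyticAt ℂ f 0) (n : ℕ) :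
    taylorCoeff (dslope f 0) n = taylorCoeff f (n + 1) := by
  obtain ⟨p, hp⟩ := hf
  rw [taylorCoeff_eq_coeff hp.has_fpower_series_dslope_fslope, taylorCoeff_eq_coeff hp,
    FormalMultilinearSeries.coeff_fslope]

lemma analyticAt_dslope {𝕜 E : Type*} [NontriviallyNormedField 𝕜] [NormedAddCommGroup E]
    [NormedSpace 𝕜 E] {f : 𝕜 → E} {a : 𝕜} (hf : AnalyticAt 𝕜 f a) :
    AnalyticAt 𝕜 (dslope f a) a :=
  let ⟨_, hp⟩ := hf
  hp.has_fpower_series_dslope_fslope.analyticAt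

lemma taylorCoeff_deriv (f : ℂ → ℂ) (n : ℕ) :
    taylorCoeff (deriv f) n = (n + 1) * taylorCoeff f (n + 1) := by
  have hfactorial : (n.factorial : ℂ) ≠ 0 := Nat.cast_ne_zero.2 n.factorial_ne_zero
  have hsucc : (n + 1 : ℂ) ≠ 0 := Nat.cast_add_one_ne_zero n
  simp only [taylorCoeff, iteratedDeriv_succ', Nat.factorial_succ, Nat.cast_mul, Nat.cast_add,
    Nat.cast_one]
  field_simp

lemma taylorCoeff_const_mul (c : ℂ) (f : ℂ → ℂ) (n : ℕ) :
    taylorCoeff (fun z => c * f z) n = c * taylorCoeff f n := by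
  simp only [taylorCoeff, mul_div_assoc', iteratedDeriv_const_mul_field]

lemma taylorCoeff_const_sub (c : ℂ) (f : ℂ → ℂ) {n : ℕ} (hn : n ≠ 0) :
    taylorCoeff (fun z => c - f z) n = -taylorCoeff f n := by
  simp only [taylorCoeff, iteratedDeriv_const_sub hn.bot_lt, iteratedDeriv_neg, neg_div]

lemma taylorCoeff_add (hf : AnalyticAt ℂ f 0) (hg : AnalyticAt ℂ g 0) (n : ℕ) :
    taylorCoeff (f + g) n = taylorCoeff f n + taylorCoeff g n := by
  simp only [taylorCoeff, iteratedDeriv_add hf.contDiffAt hg.contDiffAt, add_div]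

lemma taylorCoeff_sub (hf : AnalyticAt ℂ f 0) (hg : AnalyticAt ℂ g 0) (n : ℕ) :
    taylorCoeff (f - g) n = taylorCoeff f n - taylorCoeff g n := by
  simp only [taylorCoeff, iteratedDeriv_sub hf.contDiffAt hg.contDiffAt, sub_div]

lemma taylorCoeff_mul (hf : AnalyticAt ℂ f 0) (hg : AnalyticAt ℂ g 0) (n : ℕ) :
    taylorCoeff (fun z => f z * g z) n =
      ∑ ij ∈ antidiagonal n, taylorCoeff f ij.1 * taylorCoeff g ij.2 := by
  rw [Finset.Nat.sum_antidiagonal_eq_sum_range_succ_mk, taylorCoeff,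
    iteratedDeriv_fun_mul hf.contDiffAt hg.contDiffAt, Finset.sum_div]
  refine Finset.sum_congr rfl fun i hi => ?_
  have hchoose := Nat.choose_mul_factorial_mul_factorial (Finset.mem_range_succ_iff.1 hi)
  have hfactorial (m : ℕ) : (m.factorial : ℂ) ≠ 0 := Nat.cast_ne_zero.2 m.factorial_ne_zero
  rw [taylorCoeff, taylorCoeff, div_mul_div_comm,
    div_eq_div_iff (hfactorial n) (mul_ne_zero (hfactorial _) (hfactorial _)), ← hchoose]
  push_cast
  ring

end TaylorCoeff

section Caratheodory

variable {p φ : ℂ → ℂ} {ρ : ℝ} {n : ℕ}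

lemma norm_circleAverage_le_circleAverage_norm {E : Type*} [NormedAddCommGroup E]
    [NormedSpace ℝ E] (f : ℂ → E) (c : ℂ) (R : ℝ) :
    ‖Real.circleAverage f c R‖ ≤ Real.circleAverage (fun z => ‖f z‖) c R := by
  rw [Real.circleAverage, Real.circleAverage, norm_smul, smul_eq_mul,
    Real.norm_of_nonneg (by positivity)]
  gcongr
  exact intervalIntegral.norm_integral_le_integral_norm (by positivity)

lemma circleAverage_eq_of_differentiableOn_closedBall (hp : DifferentiableOn ℂ p (closedBall 0 ρ))
    (hρ : 0 ≤ ρ) : Real.circleAverage p 0 ρ = p 0 := by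
  refine DiffContOnCl.circleAverage ?_
  rw [abs_of_nonneg hρ]
  exact (hp.mono closure_ball_subset_closedBall).diffContOnCl

lemma circleAverage_conj_pow_mul (hp : DifferentiableOn ℂ p (closedBall 0 ρ)) (hρ : 0 < ρ)
    (n : ℕ) :
    Real.circleAverage (fun z => conj z ^ n * p z) 0 ρ = ρ ^ (2 * n) * taylorCoeff p n := by
  have hcauchy : Real.circleAverage (fun z => 1 / z ^ n * p z) 0 ρ = taylorCoeff p n := by
    have hintegral := hp.circleIntegral_one_div_sub_center_pow_smul hρ n
    have hintegrand (z : ℂ) : (z - 0)⁻¹ • (1 / z ^ n * p z) = (1 / (z - 0) ^ (n + 1)) • p z := by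
      simp only [sub_zero, smul_eq_mul, pow_succ, one_div, mul_inv]
      ring
    rw [Real.circleAverage_eq_circleIntegral hρ.ne', funext hintegrand, hintegral, taylorCoeff,
      smul_eq_mul, smul_eq_mul]
    field_simp [Complex.two_pi_I_ne_zero]
  have hsphere : EqOn (fun z => conj z ^ n * p z)
      (fun z => ((ρ : ℂ) ^ (2 * n)) • (1 / z ^ n * p z)) (sphere 0 |ρ|) := fun z hz => by
    rw [abs_of_pos hρ] at hz
    have hz0 : z ≠ 0 := ne_of_mem_sphere hz hρ.ne'
    have hconj : conj z * z = (ρ : ℂ) ^ 2 := by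
      rw [Complex.conj_mul', mem_sphere_zero_iff_norm.1 hz]
    simp only [pow_mul, ← hconj, mul_pow, smul_eq_mul]
    field_simp
  rw [Real.circleAverage_congr_sphere hsphere, Real.circleAverage_fun_smul, hcauchy, smul_eq_mul]

lemma circleAverage_conj_pow_mul_conj (hp : DifferentiableOn ℂ p (closedBall 0 ρ)) (hρ : 0 ≤ ρ)
    (hn : n ≠ 0) : Real.circleAverage (fun z => conj z ^ n * conj (p z)) 0 ρ = 0 := by
  have hmul : DifferentiableOn ℂ (fun z => z ^ n * p z) (closedBall 0 ρ) :=
    (differentiableOn_id.pow n).mul hp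
  have hcomm := (Complex.conjCLE : ℂ →L[ℝ] ℂ).circleAverage_comp_comm
    ((hmul.continuousOn.mono sphere_subset_closedBall).circleIntegrable hρ)
  rw [circleAverage_eq_of_differentiableOn_closedBall hmul hρ, zero_pow hn, zero_mul,
    map_zero] at hcomm
  simpa only [Function.comp_def, ContinuousLinearEquiv.coe_coe, Complex.conjCLE_apply, map_mul,
    map_pow] using hcomm

lemma circleAverage_conj_pow_mul_two_re (hp : DifferentiableOn ℂ p (closedBall 0 ρ)) (hρ : 0 < ρ)
    (hn : n ≠ 0) :
    Real.circleAverage (fun z => conj z ^ n * ((2 * (p z).re : ℝ) : ℂ)) 0 ρ =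
      ρ ^ (2 * n) * taylorCoeff p n := by
  have hcont : ContinuousOn p (sphere 0 ρ) := hp.continuousOn.mono sphere_subset_closedBall
  have hint {F : ℂ → ℂ} (hF : ContinuousOn F (sphere 0 ρ)) :
      CircleIntegrable (fun z => conj z ^ n * F z) 0 ρ :=
    ((Complex.continuous_conj.pow n).continuousOn.mul hF).circleIntegrable hρ.le
  have hadd := Real.circleAverage_fun_add (hint hcont)
    (hint (Complex.continuous_conj.comp_continuousOn hcont))
  simpa only [Function.comp_apply, ← mul_add, Complex.add_conj, circleAverage_conj_pow_mul hp hρ,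
    circleAverage_conj_pow_mul_conj hp hρ.le hn, add_zero] using hadd

lemma norm_taylorCoeff_mul_pow_le (hp : DifferentiableOn ℂ p (closedBall 0 ρ))
    (hre : ∀ z ∈ sphere 0 ρ, 0 ≤ (p z).re) (hρ : 0 < ρ) (hn : n ≠ 0) :
    ‖taylorCoeff p n‖ * ρ ^ n ≤ 2 * (p 0).re := by
  have hnorm : EqOn (fun z => ‖conj z ^ n * ((2 * (p z).re : ℝ) : ℂ)‖)
      (fun z => (2 * ρ ^ n) • (p z).re) (sphere 0 |ρ|) := fun z hz => by
    rw [abs_of_pos hρ] at hz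
    simp only [norm_mul, norm_pow, RCLike.norm_conj, mem_sphere_zero_iff_norm.1 hz,
      Complex.norm_real, Real.norm_ofNat, Real.norm_of_nonneg (hre z hz), smul_eq_mul]
    ring
  have hmean : Real.circleAverage (fun z => (p z).re) 0 ρ = (p 0).re := by
    rw [← circleAverage_eq_of_differentiableOn_closedBall hp hρ.le]
    exact Complex.reCLM.circleAverage_comp_comm
      ((hp.continuousOn.mono sphere_subset_closedBall).circleIntegrable hρ.le)
  refine le_of_mul_le_mul_left ?_ (pow_pos hρ n)
  calc ρ ^ n * (‖taylorCoeff p n‖ * ρ ^ n)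
      = ‖(ρ : ℂ) ^ (2 * n) * taylorCoeff p n‖ := by
        rw [norm_mul, norm_pow, Complex.norm_of_nonneg hρ.le]; ring
    _ ≤ Real.circleAverage (fun z => (2 * ρ ^ n) • (p z).re) 0 ρ := by
        rw [← circleAverage_conj_pow_mul_two_re hp hρ hn, ← Real.circleAverage_congr_sphere hnorm]
        exact norm_circleAverage_le_circleAverage_norm _ _ _
    _ = ρ ^ n * (2 * (p 0).re) := by
        rw [Real.circleAverage_fun_smul, hmean, smul_eq_mul]; ring

theorem norm_taylorCoeff_le_of_re_nonneg (hp : DifferentiableOn ℂ p unitDisk)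
    (hre : ∀ z ∈ unitDisk, 0 ≤ (p z).re) (hn : n ≠ 0) : ‖taylorCoeff p n‖ ≤ 2 * (p 0).re := by
  have hlim : Filter.Tendsto (fun ρ : ℝ => ‖taylorCoeff p n‖ * ρ ^ n) (nhdsWithin 1 (Iio 1))
      (nhds (‖taylorCoeff p n‖ * 1 ^ n)) :=
    ((continuous_const.mul (continuous_pow n)).tendsto 1).mono_left nhdsWithin_le_nhds
  rw [one_pow, mul_one] at hlim
  refine le_of_tendsto hlim ?_
  filter_upwards [Ioo_mem_nhdsLT (zero_lt_one (α := ℝ))] with ρ ⟨hρ0, hρ1⟩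
  have hsub : closedBall (0 : ℂ) ρ ⊆ unitDisk := closedBall_subset_ball hρ1
  exact norm_taylorCoeff_mul_pow_le (hp.mono hsub)
    (fun z hz => hre z (hsub (sphere_subset_closedBall hz))) hρ0 hn

lemma taylorCoeff_eq_zero_of_re_eq_zero (hp : DifferentiableOn ℂ p unitDisk)
    (hre : ∀ z ∈ unitDisk, (p z).re = 0) (hn : n ≠ 0) : taylorCoeff p n = 0 := by
  have hle := norm_taylorCoeff_le_of_re_nonneg hp (fun z hz => (hre z hz).ge) hn
  rwa [hre 0 zero_mem_unitDisk, mul_zero, norm_le_zero_iff] at hle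

lemma norm_taylorCoeff_le_of_norm_le (hφ : DifferentiableOn ℂ φ unitDisk) {C : ℝ}
    (hC : ∀ z ∈ unitDisk, ‖φ z‖ ≤ C) (hn : n ≠ 0) : ‖taylorCoeff φ n‖ ≤ 2 * (C - ‖φ 0‖) := by
  obtain ⟨u, hu, hu0⟩ := Complex.exists_norm_eq_mul_self (φ 0)
  have hre : ∀ z ∈ unitDisk, 0 ≤ ((C : ℂ) - u * φ z).re := fun z hz => by
    have hle := (Complex.re_le_norm (u * φ z)).trans_eq (by rw [norm_mul, hu, one_mul])
    simpa using hle.trans (hC z hz)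
  have hcoeff := norm_taylorCoeff_le_of_re_nonneg ((hφ.const_mul u).const_sub _) hre hn
  rwa [taylorCoeff_const_sub _ _ hn, norm_neg, taylorCoeff_const_mul, norm_mul, hu, one_mul,
    ← hu0, Complex.sub_re, Complex.ofReal_re, Complex.ofReal_re] at hcoeff

end Caratheodory

section Majorant

open Finset.HasAntidiagonal (antidiagonal)

variable {f g u φ w ω : ℂ → ℂ} {r : ℝ}

/-- The `N`-th partial sum of the majorant series `∑ |a_m| r^m` of `f = ∑ a_m z^m`. For the series
without its constant term, divided by `r`, apply it to `dslope f 0 = ∑ a_{m+1} z^m`. -/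
noncomputable def majorantSum (f : ℂ → ℂ) (r : ℝ) (N : ℕ) : ℝ :=
  ∑ m ∈ Finset.range N, ‖taylorCoeff f m‖ * r ^ m

lemma majorantSum_nonneg (f : ℂ → ℂ) (hr : 0 ≤ r) (N : ℕ) : 0 ≤ majorantSum f r N :=
  Finset.sum_nonneg fun _ _ => by positivity

lemma majorantSum_succ (hf : AnalyticAt ℂ f 0) (r : ℝ) (N : ℕ) :
    majorantSum f r (N + 1) = ‖f 0‖ + r * majorantSum (dslope f 0) r N := by
  simp only [majorantSum, taylorCoeff_dslope hf, Finset.sum_range_succ', taylorCoeff_zero,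
    pow_succ, pow_zero, mul_one, Finset.mul_sum]
  rw [add_comm]
  congr 1
  exact Finset.sum_congr rfl fun m _ => by ring

lemma sum_range_sum_antidiagonal_mul_le {R : Type*} [CommSemiring R] [PartialOrder R]
    [IsOrderedRing R] {a b : ℕ → R} (ha : ∀ n, 0 ≤ a n) (hb : ∀ n, 0 ≤ b n) (N : ℕ) :
    ∑ m ∈ Finset.range N, ∑ ij ∈ antidiagonal m, a ij.1 * b ij.2 ≤
      (∑ m ∈ Finset.range N, a m) * ∑ m ∈ Finset.range N, b m := by
  simp only [Finset.Nat.sum_antidiagonal_eq_sum_range_succ_mk, Finset.sum_mul_sum]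
  rw [Finset.sum_range_diag_flip N fun i j => a i * b j]
  exact Finset.sum_le_sum fun i _ => Finset.sum_le_sum_of_subset_of_nonneg
    (Finset.range_mono (Nat.sub_le N i)) fun j _ _ => mul_nonneg (ha i) (hb j)

lemma majorantSum_le_mul_of_norm_taylorCoeff_le
    (h : ∀ n, ‖taylorCoeff u n‖ ≤
      ∑ ij ∈ antidiagonal n, ‖taylorCoeff f ij.1‖ * ‖taylorCoeff g ij.2‖) (hr : 0 ≤ r) (N : ℕ) :
    majorantSum u r N ≤ majorantSum f r N * majorantSum g r N := by
  refine le_trans (Finset.sum_le_sum fun n _ => ?_) (sum_range_sum_antidiagonal_mul_le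
    (a := fun n => ‖taylorCoeff f n‖ * r ^ n) (b := fun n => ‖taylorCoeff g n‖ * r ^ n)
    (fun n => by positivity) (fun n => by positivity) N)
  calc ‖taylorCoeff u n‖ * r ^ n
      ≤ (∑ ij ∈ antidiagonal n, ‖taylorCoeff f ij.1‖ * ‖taylorCoeff g ij.2‖) * r ^ n := by
        gcongr
        exact h n
    _ = _ := by
        rw [Finset.sum_mul]
        refine Finset.sum_congr rfl fun ij hij => ?_
        rw [← Finset.HasAntidiagonal.mem_antidiagonal.1 hij, pow_add]
        ring

lemma majorantSum_mul_le (hf : AnalyticAt ℂ f 0) (hg : AnalyticAt ℂ g 0) (hr : 0 ≤ r) (N : ℕ) :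
    majorantSum (fun z => f z * g z) r N ≤ majorantSum f r N * majorantSum g r N := by
  refine majorantSum_le_mul_of_norm_taylorCoeff_le (fun n => ?_) hr N
  rw [taylorCoeff_mul hf hg]
  exact (norm_sum_le _ _).trans_eq (by simp only [norm_mul])

theorem majorantSum_le_of_norm_le (hφ : DifferentiableOn ℂ φ unitDisk) {C : ℝ}
    (hC : ∀ z ∈ unitDisk, ‖φ z‖ ≤ C) (hr : 0 ≤ r) (hr3 : r ≤ 1 / 3) (N : ℕ) :
    majorantSum φ r N ≤ C := by
  have hφ0 := analyticAt_zero_of_differentiableOn hφ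
  have h0 : ‖φ 0‖ ≤ C := hC 0 zero_mem_unitDisk
  have hgeom : ∑ m ∈ Finset.range N, r ^ m ≤ (1 - r)⁻¹ :=
    sum_le_hasSum _ (fun _ _ => by positivity) (hasSum_geometric_of_lt_one hr (by linarith))
  have hratio : 2 * (r * (1 - r)⁻¹) ≤ 1 := by
    rw [← div_eq_mul_inv, mul_div_assoc', div_le_one (by linarith)]
    linarith
  calc majorantSum φ r N ≤ majorantSum φ r (N + 1) := by
        rw [majorantSum, majorantSum, Finset.sum_range_succ]
        exact le_add_of_nonneg_right (by positivity)
    _ = ‖φ 0‖ + r * ∑ m ∈ Finset.range N, ‖taylorCoeff φ (m + 1)‖ * r ^ m := by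
        rw [majorantSum_succ hφ0, majorantSum]
        simp only [taylorCoeff_dslope hφ0]
    _ ≤ ‖φ 0‖ + r * ∑ m ∈ Finset.range N, 2 * (C - ‖φ 0‖) * r ^ m := by
        gcongr with m
        exact norm_taylorCoeff_le_of_norm_le hφ hC m.succ_ne_zero
    _ ≤ ‖φ 0‖ + r * (2 * (C - ‖φ 0‖) * (1 - r)⁻¹) := by
        rw [← Finset.mul_sum]
        gcongr
    _ ≤ C := by nlinarith [mul_le_mul_of_nonneg_left hratio (sub_nonneg.2 h0)]

lemma IsSchwarz.norm_dslope_le (hw : IsSchwarz w) {z : ℂ} (hz : z ∈ unitDisk) :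
    ‖dslope w 0 z‖ ≤ 1 := by
  have hmaps : MapsTo w (ball 0 1) (closedBall (w 0) 1) := fun x hx => by
    rw [hw.map_zero]
    exact ball_subset_closedBall (hw.mapsTo hx)
  simpa using Complex.norm_dslope_le_div_of_mapsTo_ball hw.analytic hmaps hz

lemma dslope_comp_eq_mul {𝕜 : Type*} [NontriviallyNormedField 𝕜] {f w : 𝕜 → 𝕜} {a : 𝕜}
    (hf : DifferentiableAt 𝕜 f (w a)) (hw : DifferentiableAt 𝕜 w a) (z : 𝕜) :
    dslope (f ∘ w) a z = dslope w a z * dslope f (w a) (w z) := by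
  rcases eq_or_ne z a with rfl | hz
  · simp only [dslope_same]
    exact (deriv_comp z hf hw).trans (mul_comm _ _)
  · have hfw := sub_smul_dslope f (w a) (w z)
    rw [dslope_of_ne _ hz, dslope_of_ne _ hz, slope_def_field, slope_def_field, Function.comp_apply,
      Function.comp_apply, ← hfw, smul_eq_mul]
    ring

lemma IsSchwarz.majorantSum_dslope_comp_le (hw : IsSchwarz w) (hf : AnalyticAt ℂ f 0)
    (hr : 0 ≤ r) (hr3 : r ≤ 1 / 3) (N : ℕ) :
    majorantSum (dslope (f ∘ w) 0) r N ≤ majorantSum (dslope f 0 ∘ w) r N := by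
  have hw0 : AnalyticAt ℂ w 0 := analyticAt_zero_of_differentiableOn hw.analytic
  have hfw0 : AnalyticAt ℂ f (w 0) := by rwa [hw.map_zero]
  have hdf0 : AnalyticAt ℂ (dslope f (w 0)) (w 0) := analyticAt_dslope hfw0
  have hfactor : dslope (f ∘ w) 0 = fun z => dslope w 0 z * (dslope f 0 ∘ w) z := funext fun z => by
    rw [dslope_comp_eq_mul hfw0.differentiableAt hw0.differentiableAt, hw.map_zero,
      Function.comp_apply]
  calc majorantSum (dslope (f ∘ w) 0) r N
      ≤ majorantSum (dslope w 0) r N * majorantSum (dslope f 0 ∘ w) r N := by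
        rw [hfactor]
        refine majorantSum_mul_le (analyticAt_dslope hw0) ?_ hr N
        simpa only [hw.map_zero] using hdf0.comp hw0
    _ ≤ 1 * majorantSum (dslope f 0 ∘ w) r N := by
        gcongr
        · exact majorantSum_nonneg _ hr N
        · exact majorantSum_le_of_norm_le (differentiableOn_dslope_zero hw.analytic)
            (fun z => hw.norm_dslope_le) hr hr3 N
    _ = _ := one_mul _

theorem IsSchwarz.majorantSum_comp_le (hw : IsSchwarz w) (hf : AnalyticAt ℂ f 0) (hr : 0 ≤ r)
    (hr3 : r ≤ 1 / 3) (N : ℕ) : majorantSum (f ∘ w) r N ≤ majorantSum f r N := by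
  induction N generalizing f with
  | zero => simp [majorantSum]
  | succ N ih =>
    have hfw : AnalyticAt ℂ (f ∘ w) 0 :=
      AnalyticAt.comp (by rwa [hw.map_zero]) (analyticAt_zero_of_differentiableOn hw.analytic)
    rw [majorantSum_succ hfw, majorantSum_succ hf, Function.comp_apply, hw.map_zero]
    gcongr
    exact (hw.majorantSum_dslope_comp_le hf hr hr3 N).trans (ih (analyticAt_dslope hf))

theorem majorantSum_dslope_le_of_deriv_eq_mul (hf : AnalyticAt ℂ f 0)
    (hg : AnalyticAt ℂ g 0) (hω : DifferentiableOn ℂ ω unitDisk) {k : ℝ}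
    (hωk : ∀ z ∈ unitDisk, ‖ω z‖ ≤ k) (hderiv : deriv g =ᶠ[nhds 0] fun z => ω z * deriv f z)
    (hr : 0 ≤ r) (hr3 : r ≤ 1 / 3) (N : ℕ) :
    majorantSum (dslope g 0) r N ≤ k * majorantSum (dslope f 0) r N := by
  have hω0 := analyticAt_zero_of_differentiableOn hω
  refine (majorantSum_le_mul_of_norm_taylorCoeff_le (f := ω) (g := dslope f 0)
    (fun n => ?_) hr N).trans (mul_le_mul_of_nonneg_right
      (majorantSum_le_of_norm_le hω hωk hr hr3 N) (majorantSum_nonneg _ hr N))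
  refine le_of_mul_le_mul_left ?_ (by positivity : (0 : ℝ) < n + 1)
  have hnorm (m : ℕ) : ‖(m + 1 : ℂ)‖ = m + 1 := by
    rw [← Nat.cast_add_one, Complex.norm_natCast, Nat.cast_add_one]
  simp only [taylorCoeff_dslope hf, taylorCoeff_dslope hg]
  calc (n + 1) * ‖taylorCoeff g (n + 1)‖
      = ‖∑ ij ∈ antidiagonal n, taylorCoeff ω ij.1 * ((ij.2 + 1) * taylorCoeff f (ij.2 + 1))‖ := by
        rw [← hnorm, ← norm_mul, ← taylorCoeff_deriv, taylorCoeff_congr hderiv,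
          taylorCoeff_mul hω0 hf.deriv]
        simp only [taylorCoeff_deriv]
    _ ≤ ∑ ij ∈ antidiagonal n,
          ‖taylorCoeff ω ij.1‖ * ((ij.2 + 1) * ‖taylorCoeff f (ij.2 + 1)‖) :=
        (norm_sum_le _ _).trans_eq (by simp only [norm_mul, hnorm])
    _ ≤ ∑ ij ∈ antidiagonal n,
          (n + 1) * (‖taylorCoeff ω ij.1‖ * ‖taylorCoeff f (ij.2 + 1)‖) := by
        refine Finset.sum_le_sum fun ij hij => ?_
        rw [mul_left_comm]
        gcongr
        exact (le_add_left le_rfl).trans_eq (Finset.HasAntidiagonal.mem_antidiagonal.1 hij)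
    _ = _ := (Finset.mul_sum _ _ _).symm

end Majorant

section HarmonicSubordination

variable {f g f₁ g₁ f₂ g₂ u v ω : ℂ → ℂ} {r k : ℝ}

lemma taylorCoeff_eq_zero_of_harmonicMap_eq_zero (hu : DifferentiableOn ℂ u unitDisk)
    (hv : DifferentiableOn ℂ v unitDisk) (h : ∀ z ∈ unitDisk, harmonicMap u v z = 0) {n : ℕ}
    (hn : n ≠ 0) : taylorCoeff u n = 0 ∧ taylorCoeff v n = 0 := by
  have hre (z : ℂ) (hz : z ∈ unitDisk) : (u z).re + (v z).re = 0 := by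
    simpa [harmonicMap] using congrArg Complex.re (h z hz)
  have him (z : ℂ) (hz : z ∈ unitDisk) : (u z).im - (v z).im = 0 := by
    simpa [harmonicMap, sub_eq_add_neg] using congrArg Complex.im (h z hz)
  have hu0 := analyticAt_zero_of_differentiableOn hu
  have hv0 := analyticAt_zero_of_differentiableOn hv
  have hadd : taylorCoeff (u + v) n = 0 :=
    taylorCoeff_eq_zero_of_re_eq_zero (hu.add hv) (fun z hz => by simpa using hre z hz) hn
  have hsub : taylorCoeff (fun z => Complex.I * (u - v) z) n = 0 :=
    taylorCoeff_eq_zero_of_re_eq_zero ((hu.sub hv).const_mul _)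
      (fun z hz => by simpa using congrArg Neg.neg (him z hz)) hn
  rw [taylorCoeff_add hu0 hv0] at hadd
  rw [taylorCoeff_const_mul, taylorCoeff_sub hu0 hv0, mul_eq_zero_iff_left Complex.I_ne_zero,
    sub_eq_zero] at hsub
  rw [hsub, ← two_mul, mul_eq_zero_iff_left two_ne_zero] at hadd
  exact ⟨hsub.trans hadd, hadd⟩

lemma taylorCoeff_eq_of_harmonicMap_eq (hf₁ : DifferentiableOn ℂ f₁ unitDisk)
    (hg₁ : DifferentiableOn ℂ g₁ unitDisk) (hf₂ : DifferentiableOn ℂ f₂ unitDisk)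
    (hg₂ : DifferentiableOn ℂ g₂ unitDisk)
    (h : EqOn (harmonicMap f₁ g₁) (harmonicMap f₂ g₂) unitDisk) {n : ℕ} (hn : n ≠ 0) :
    taylorCoeff f₁ n = taylorCoeff f₂ n ∧ taylorCoeff g₁ n = taylorCoeff g₂ n := by
  have hzero : ∀ z ∈ unitDisk, harmonicMap (f₁ - f₂) (g₁ - g₂) z = 0 := fun z hz => by
    simpa [harmonicMap, sub_add_sub_comm, sub_eq_zero] using h hz
  obtain ⟨hf, hg⟩ :=
    taylorCoeff_eq_zero_of_harmonicMap_eq_zero (hf₁.sub hf₂) (hg₁.sub hg₂) hzero hn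
  rw [taylorCoeff_sub (analyticAt_zero_of_differentiableOn hf₁)
    (analyticAt_zero_of_differentiableOn hf₂), sub_eq_zero] at hf
  rw [taylorCoeff_sub (analyticAt_zero_of_differentiableOn hg₁)
    (analyticAt_zero_of_differentiableOn hg₂), sub_eq_zero] at hg
  exact ⟨hf, hg⟩

lemma sum_bohrTerm_eq (hf₁ : AnalyticAt ℂ f₁ 0) (hg₁ : AnalyticAt ℂ g₁ 0) (r : ℝ) (N : ℕ) :
    ∑ n ∈ Finset.range N, bohrTerm f₁ g₁ r n =
      r * (majorantSum (dslope f₁ 0) r N + majorantSum (dslope g₁ 0) r N) := by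
  simp only [bohrTerm, majorantSum, taylorCoeff_dslope hf₁, taylorCoeff_dslope hg₁,
    ← Finset.sum_add_distrib, Finset.mul_sum, pow_succ]
  exact Finset.sum_congr rfl fun n _ => by ring

theorem IsHarmonicSubordinate.exists_isSchwarz_bohrTerm_eq
    (h : IsHarmonicSubordinate f₁ g₁ f g) (hf : DifferentiableOn ℂ f unitDisk)
    (hg : DifferentiableOn ℂ g unitDisk) :
    ∃ w, IsSchwarz w ∧ ∀ r, bohrTerm f₁ g₁ r = bohrTerm (f ∘ w) (g ∘ w) r := by
  obtain ⟨w, hw, hsub⟩ := h.subordinate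
  refine ⟨w, hw, fun r => funext fun n => ?_⟩
  obtain ⟨hfw, hgw⟩ := taylorCoeff_eq_of_harmonicMap_eq h.analytic_left h.analytic_right
    (hf.comp hw.analytic hw.mapsTo) (hg.comp hw.analytic hw.mapsTo) hsub n.succ_ne_zero
  rw [bohrTerm, bohrTerm, hfw, hgw]

theorem IsHarmonicSubordinate.sum_bohrTerm_le (h : IsHarmonicSubordinate f₁ g₁ f g)
    (hf : DifferentiableOn ℂ f unitDisk) (hg : DifferentiableOn ℂ g unitDisk)
    (hω : DifferentiableOn ℂ ω unitDisk) (hωk : ∀ z ∈ unitDisk, ‖ω z‖ ≤ k)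
    (hderiv : deriv g =ᶠ[nhds 0] fun z => ω z * deriv f z) (hr : 0 ≤ r) (hr3 : r ≤ 1 / 3)
    (N : ℕ) :
    ∑ n ∈ Finset.range N, bohrTerm f₁ g₁ r n ≤ (1 + k) * (r * majorantSum (dslope f 0) r N) := by
  obtain ⟨w, hw, hterm⟩ := h.exists_isSchwarz_bohrTerm_eq hf hg
  have hf0 := analyticAt_zero_of_differentiableOn hf
  have hg0 := analyticAt_zero_of_differentiableOn hg
  have hdslope {F : ℂ → ℂ} (hF : AnalyticAt ℂ F 0) :
      majorantSum (dslope (F ∘ w) 0) r N ≤ majorantSum (dslope F 0) r N :=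
    (hw.majorantSum_dslope_comp_le hF hr hr3 N).trans
      (hw.majorantSum_comp_le (analyticAt_dslope hF) hr hr3 N)
  calc ∑ n ∈ Finset.range N, bohrTerm f₁ g₁ r n
      = r * (majorantSum (dslope (f ∘ w) 0) r N + majorantSum (dslope (g ∘ w) 0) r N) := by
        simp only [hterm]
        exact sum_bohrTerm_eq
          (analyticAt_zero_of_differentiableOn (hf.comp hw.analytic hw.mapsTo))
          (analyticAt_zero_of_differentiableOn (hg.comp hw.analytic hw.mapsTo)) r N
    _ ≤ r * (majorantSum (dslope f 0) r N + k * majorantSum (dslope f 0) r N) := by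
        gcongr
        · exact hdslope hf0
        · exact (hdslope hg0).trans
            (majorantSum_dslope_le_of_deriv_eq_mul hf0 hg0 hω hωk hderiv hr hr3 N)
    _ = (1 + k) * (r * majorantSum (dslope f 0) r N) := by ring

end HarmonicSubordination

section Starlike

variable {f L F w : ℂ → ℂ} {z : ℂ}

lemma IsSchwarz.norm_le (hw : IsSchwarz w) (hz : z ∈ unitDisk) : ‖w z‖ ≤ ‖z‖ := by
  have hfactor := sub_smul_dslope w 0 z
  rw [hw.map_zero, sub_zero, sub_zero, smul_eq_mul] at hfactor
  rw [← hfactor, norm_mul]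
  exact mul_le_of_le_one_right (norm_nonneg _) (hw.norm_dslope_le hz)

lemma le_re_cayley (hz : z ∈ unitDisk) :
    (1 - ‖z‖) / (1 + ‖z‖) ≤ ((1 + z) / (1 - z)).re := by
  have hre : ((1 + z) / (1 - z)).re = (1 - ‖z‖ ^ 2) / ‖1 - z‖ ^ 2 := by
    rw [Complex.div_re, ← Complex.normSq_eq_norm_sq, ← Complex.normSq_eq_norm_sq, ← add_div]
    congr 1
    simp only [Complex.normSq_apply, Complex.add_re, Complex.sub_re, Complex.add_im,
      Complex.sub_im, Complex.one_re, Complex.one_im]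
    ring
  have hnorm : ‖1 - z‖ ≤ 1 + ‖z‖ := (norm_sub_le _ _).trans_eq (by rw [norm_one])
  have hpos : 0 < ‖1 - z‖ := norm_pos_iff.2 (one_sub_ne_zero_of_mem_unitDisk hz)
  have hnonneg : 0 ≤ 1 - ‖z‖ ^ 2 := by
    nlinarith [norm_nonneg z, (mem_unitDisk_iff.1 hz).le]
  calc (1 - ‖z‖) / (1 + ‖z‖) = (1 - ‖z‖ ^ 2) / (1 + ‖z‖) ^ 2 := by field_simp; ring
    _ ≤ _ := by rw [hre]; gcongr

lemma one_sub_div_one_add_pos (hz : z ∈ unitDisk) : 0 < (1 - ‖z‖) / (1 + ‖z‖) :=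
  div_pos (sub_pos.2 (mem_unitDisk_iff.1 hz)) (by positivity)

lemma starlikeQuotient_zero (f : ℂ → ℂ) : starlikeQuotient f 0 = 1 := if_pos rfl

lemma differentiableOn_starlikeQuotient (hf : f ∈ starlikeClass) :
    DifferentiableOn ℂ (starlikeQuotient f) unitDisk := by
  obtain ⟨-, -, w, hw, hsub⟩ := hf
  exact ((hw.analytic.const_add 1).div (hw.analytic.const_sub 1) fun z hz =>
    one_sub_ne_zero_of_mem_unitDisk (hw.mapsTo hz)).congr hsub

lemma le_re_starlikeQuotient (hf : f ∈ starlikeClass) (hz : z ∈ unitDisk) :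
    (1 - ‖z‖) / (1 + ‖z‖) ≤ (starlikeQuotient f z).re := by
  obtain ⟨-, -, w, hw, hsub⟩ := hf
  calc (1 - ‖z‖) / (1 + ‖z‖) ≤ (1 - ‖w z‖) / (1 + ‖w z‖) := by
        have := mem_unitDisk_iff.1 (hw.mapsTo hz)
        have := hw.norm_le hz
        gcongr
    _ ≤ _ := by
        rw [hsub z hz]
        exact le_re_cayley (hw.mapsTo hz)

lemma re_starlikeQuotient_pos (hf : f ∈ starlikeClass) (hz : z ∈ unitDisk) :
    0 < (starlikeQuotient f z).re :=
  (one_sub_div_one_add_pos hz).trans_le (le_re_starlikeQuotient hf hz)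

lemma mul_dslope_zero (hf0 : f 0 = 0) (z : ℂ) : z * dslope f 0 z = f z := by
  simpa only [hf0, sub_zero, smul_eq_mul] using sub_smul_dslope f 0 z

lemma dslope_zero_ne_zero (hf : f ∈ starlikeClass) (hz : z ∈ unitDisk) : dslope f 0 z ≠ 0 := by
  obtain ⟨⟨-, hf0, hf1⟩, hne, -⟩ := hf
  rcases eq_or_ne z 0 with rfl | hz0
  · simp [hf1]
  · exact right_ne_zero_of_mul ((mul_dslope_zero hf0 z).trans_ne (hne z hz hz0))

lemma deriv_eq_dslope_mul_starlikeQuotient (hf : f ∈ starlikeClass) (hz : z ∈ unitDisk) :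
    deriv f z = dslope f 0 z * starlikeQuotient f z := by
  rcases eq_or_ne z 0 with rfl | hz0
  · rw [dslope_same, starlikeQuotient_zero, mul_one]
  · have hdslope := dslope_zero_ne_zero hf hz
    rw [starlikeQuotient, if_neg hz0, ← mul_dslope_zero hf.1.2.1 z]
    field_simp

lemma deriv_ne_zero_of_mem_starlikeClass (hf : f ∈ starlikeClass) (hz : z ∈ unitDisk) :
    deriv f z ≠ 0 := by
  rw [deriv_eq_dslope_mul_starlikeQuotient hf hz]
  refine mul_ne_zero (dslope_zero_ne_zero hf hz) fun h => ?_
  simpa [h] using re_starlikeQuotient_pos hf hz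

lemma norm_taylorCoeff_starlikeQuotient_le (hf : f ∈ starlikeClass) {n : ℕ} (hn : n ≠ 0) :
    ‖taylorCoeff (starlikeQuotient f) n‖ ≤ 2 := by
  simpa [starlikeQuotient_zero] using norm_taylorCoeff_le_of_re_nonneg
    (differentiableOn_starlikeQuotient hf) (fun z hz => (re_starlikeQuotient_pos hf hz).le) hn

lemma mul_taylorCoeff_succ_eq_sum (hf : f ∈ starlikeClass) (n : ℕ) :
    n * taylorCoeff f (n + 1) = ∑ i ∈ Finset.range n,
      taylorCoeff f (i + 1) * taylorCoeff (starlikeQuotient f) (n - i) := by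
  have hf0 := analyticAt_zero_of_differentiableOn hf.1.1
  have hderiv : deriv f =ᶠ[nhds 0] fun z => dslope f 0 z * starlikeQuotient f z :=
    eventuallyEq_zero_of_eqOn_unitDisk fun z => deriv_eq_dslope_mul_starlikeQuotient hf
  have hcoeff := taylorCoeff_congr hderiv n
  rw [taylorCoeff_deriv, taylorCoeff_mul (analyticAt_dslope hf0)
    (analyticAt_zero_of_differentiableOn (differentiableOn_starlikeQuotient hf)),
    Finset.Nat.sum_antidiagonal_eq_sum_range_succ_mk, Finset.sum_range_succ] at hcoeff
  simp only [taylorCoeff_dslope hf0, Nat.sub_self, taylorCoeff_zero, starlikeQuotient_zero,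
    mul_one] at hcoeff
  linear_combination hcoeff

theorem norm_taylorCoeff_succ_le_of_mem_starlikeClass (hf : f ∈ starlikeClass) (n : ℕ) :
    ‖taylorCoeff f (n + 1)‖ ≤ n + 1 := by
  induction n using Nat.strong_induction_on with
  | _ n ih =>
    rcases Nat.eq_zero_or_pos n with rfl | hn
    · simp [taylorCoeff_one, hf.1.2.2]
    refine le_of_mul_le_mul_left ?_ (Nat.cast_pos.2 hn : (0 : ℝ) < n)
    calc (n : ℝ) * ‖taylorCoeff f (n + 1)‖
        = ‖∑ i ∈ Finset.range n,
            taylorCoeff f (i + 1) * taylorCoeff (starlikeQuotient f) (n - i)‖ := by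
          rw [← mul_taylorCoeff_succ_eq_sum hf, norm_mul, Complex.norm_natCast]
      _ ≤ ∑ i ∈ Finset.range n, ((i + 1 : ℕ) : ℝ) * 2 := by
          refine norm_sum_le_of_le _ fun i hi => ?_
          have hin : i < n := Finset.mem_range.1 hi
          rw [norm_mul, Nat.cast_add_one]
          gcongr
          · exact ih i hin
          · exact norm_taylorCoeff_starlikeQuotient_le hf (Nat.sub_ne_zero_of_lt hin)
      _ = n * (n + 1) := by
          have hgauss := Finset.sum_range_id_mul_two (n + 1)
          rw [Finset.sum_range_succ', add_zero, Nat.add_sub_cancel, mul_comm (n + 1)] at hgauss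
          rw [← Finset.sum_mul]
          exact_mod_cast hgauss

lemma exists_eq_exp_of_ne_zero {c : ℂ} {R : ℝ} (hF : DifferentiableOn ℂ F (ball c R))
    (hne : ∀ z ∈ ball c R, F z ≠ 0) :
    ∃ L : ℂ → ℂ, L c = Complex.log (F c) ∧ ∀ z ∈ ball c R,
      HasDerivAt L (deriv F z / F z) z ∧ F z = Complex.exp (L z) := by
  obtain ⟨L, hLc, hL⟩ := (DifferentiableOn.isExactOn_ball
    ((hF.deriv isOpen_ball).div hF hne)).with_val_at c (Complex.log (F c))
  refine ⟨L, hLc, fun z hz => ⟨hL z hz, ?_⟩⟩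
  have hc : c ∈ ball c R := mem_ball_self (pos_of_mem_ball hz)
  have hderiv : ∀ x ∈ ball c R, HasDerivAt (fun y => F y * Complex.exp (-L y)) 0 x := fun x hx => by
    have hFx := (hF.differentiableAt (isOpen_ball.mem_nhds hx)).hasDerivAt
    have hprod := hFx.fun_mul (hL x hx).fun_neg.cexp
    have hFne := hne x hx
    have hzero : deriv F x * Complex.exp (-L x) +
        F x * (Complex.exp (-L x) * -(deriv F x / F x)) = 0 := by
      field_simp
      ring
    exact hzero ▸ hprod
  have hconst : F z * Complex.exp (-L z) = F c * Complex.exp (-L c) :=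
    isOpen_ball.is_const_of_deriv_eq_zero (convex_ball c R).isPreconnected
      (fun x hx => (hderiv x hx).differentiableAt.differentiableWithinAt)
      (fun x hx => (hderiv x hx).deriv) hz hc
  rw [hLc, Complex.exp_neg, Complex.exp_neg, Complex.exp_log (hne c hc),
    mul_inv_cancel₀ (hne c hc)] at hconst
  exact (mul_inv_eq_one₀ (Complex.exp_ne_zero _)).1 hconst

lemma exists_eq_mul_exp_of_mem_starlikeClass (hf : f ∈ starlikeClass) :
    ∃ L : ℂ → ℂ, DifferentiableOn ℂ L unitDisk ∧ L 0 = 0 ∧ ∀ z ∈ unitDisk,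
      f z = z * Complex.exp (L z) ∧ 1 + z * deriv L z = starlikeQuotient f z := by
  obtain ⟨hfd, hf0, hf1⟩ := hf.1
  have hF := differentiableOn_dslope_zero hfd
  obtain ⟨L, hL0, hL⟩ := exists_eq_exp_of_ne_zero hF fun z => dslope_zero_ne_zero hf
  refine ⟨L, fun z hz => (hL z hz).1.differentiableAt.differentiableWithinAt,
    by rw [hL0, dslope_same, hf1, Complex.log_one], fun z hz => ⟨?_, ?_⟩⟩
  · rw [← (hL z hz).2, mul_dslope_zero hf0]
  · have hprod : deriv f z = dslope f 0 z + z * deriv (dslope f 0) z := by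
      have hmul := (hasDerivAt_id' z).fun_mul
        (hF.differentiableAt (isOpen_unitDisk.mem_nhds hz)).hasDerivAt
      simpa only [mul_dslope_zero hf0, one_mul] using hmul.deriv
    have hdslope := dslope_zero_ne_zero hf hz
    rw [deriv_eq_dslope_mul_starlikeQuotient hf hz] at hprod
    rw [(hL z hz).1.deriv]
    field_simp
    exact hprod.symm

end Starlike

section Univalence

variable {f L : ℂ → ℂ} {z : ℂ}

/- `t ↦ Re L(tz) + 2 log (1 + t|z|)` is nondecreasing on `[0, 1]`. -/
lemma neg_two_mul_log_le_re (hL : DifferentiableOn ℂ L unitDisk) (hL0 : L 0 = 0)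
    (hre : ∀ z ∈ unitDisk, (1 - ‖z‖) / (1 + ‖z‖) ≤ (1 + z * deriv L z).re) (hz : z ∈ unitDisk) :
    -(2 * Real.log (1 + ‖z‖)) ≤ (L z).re := by
  set φ : ℝ → ℝ := fun t => (L (t * z)).re + 2 * Real.log (1 + t * ‖z‖) with hφ
  set φ' : ℝ → ℝ := fun t => (z * deriv L (t * z)).re + 2 * (‖z‖ / (1 + t * ‖z‖))
  have hmem {t : ℝ} (ht : t ∈ Icc (0 : ℝ) 1) : (t : ℂ) * z ∈ unitDisk := by
    rw [mem_unitDisk_iff, norm_mul, Complex.norm_of_nonneg ht.1]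
    exact (mul_le_of_le_one_left (norm_nonneg _) ht.2).trans_lt (mem_unitDisk_iff.1 hz)
  have hpos {t : ℝ} (ht : t ∈ Icc (0 : ℝ) 1) : 0 < 1 + t * ‖z‖ :=
    add_pos_of_pos_of_nonneg one_pos (mul_nonneg ht.1 (norm_nonneg z))
  have hderiv {t : ℝ} (ht : t ∈ Icc (0 : ℝ) 1) : HasDerivAt φ (φ' t) t := by
    have hLt : HasDerivAt (fun s : ℂ => L (s * z)) (deriv L (t * z) * z) (t : ℂ) :=
      (hL.differentiableAt (isOpen_unitDisk.mem_nhds (hmem ht))).hasDerivAt.comp (t : ℂ)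
        (hasDerivAt_mul_const z)
    have hlog : HasDerivAt (fun s : ℝ => Real.log (1 + s * ‖z‖)) (‖z‖ / (1 + t * ‖z‖)) t :=
      ((hasDerivAt_mul_const ‖z‖).const_add 1).log (hpos ht).ne'
    rw [mul_comm] at hLt
    exact hLt.real_of_complex.add (hlog.const_mul 2)
  have hmono : MonotoneOn φ (Icc 0 1) := by
    refine monotoneOn_of_hasDerivWithinAt_nonneg (convex_Icc 0 1)
      (fun t ht => (hderiv ht).continuousAt.continuousWithinAt)
      (fun t ht => (hderiv (interior_subset ht)).hasDerivWithinAt) fun t ht => ?_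
    rw [interior_Icc] at ht
    have ht' := Ioo_subset_Icc_self ht
    have hle := hre _ (hmem ht')
    have hfrac : (1 - t * ‖z‖) / (1 + t * ‖z‖) = 1 - t * (2 * (‖z‖ / (1 + t * ‖z‖))) := by
      have := (hpos ht').ne'
      field_simp
      ring
    rw [norm_mul, Complex.norm_of_nonneg ht'.1, hfrac, Complex.add_re, Complex.one_re, mul_assoc,
      Complex.re_ofReal_mul] at hle
    exact nonneg_of_mul_nonneg_right (a := t) (by linarith) ht.1
  have hle := hmono (left_mem_Icc.2 zero_le_one) (right_mem_Icc.2 zero_le_one) zero_le_one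
  simp only [hφ, Complex.ofReal_zero, zero_mul, hL0, Complex.zero_re, add_zero, Real.log_one,
    mul_zero, Complex.ofReal_one, one_mul] at hle
  linarith

theorem div_one_add_sq_le_norm_of_mem_starlikeClass (hf : f ∈ starlikeClass)
    (hz : z ∈ unitDisk) : ‖z‖ / (1 + ‖z‖) ^ 2 ≤ ‖f z‖ := by
  obtain ⟨L, hL, hL0, hfL⟩ := exists_eq_mul_exp_of_mem_starlikeClass hf
  have hlog := neg_two_mul_log_le_re hL hL0
    (fun z hz => (hfL z hz).2 ▸ le_re_starlikeQuotient hf hz) hz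
  have hexp : Real.exp (-(2 * Real.log (1 + ‖z‖))) = ((1 + ‖z‖) ^ 2)⁻¹ := by
    rw [Real.exp_neg, two_mul, Real.exp_add, Real.exp_log (by positivity), sq]
  rw [(hfL z hz).1, norm_mul, Complex.norm_exp, div_eq_mul_inv, ← hexp]
  gcongr

theorem injOn_of_re_hasDerivWithinAt_pos {s : Set ℂ} (hs : Convex ℝ s) {G G' : ℂ → ℂ}
    (hG : ∀ z ∈ s, HasDerivWithinAt G (G' z) s z) (hpos : ∀ z ∈ s, 0 < (G' z).re) :
    InjOn G s := by
  intro a ha b hb hab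
  by_contra hne
  have hd : b - a ≠ 0 := sub_ne_zero.2 (Ne.symm hne)
  set γ : ℝ → ℂ := fun t => a + (t : ℂ) * (b - a) with hγ
  have hmaps : MapsTo γ (Icc 0 1) s := fun t ht => by
    simpa [hγ] using hs.add_smul_sub_mem ha hb ht
  have hderiv {t : ℝ} (ht : t ∈ Icc (0 : ℝ) 1) :
      HasDerivWithinAt (fun t => (G (γ t) / (b - a)).re) (G' (γ t)).re (Icc 0 1) t := by
    have hγt : HasDerivWithinAt γ (b - a) (Icc 0 1) t := by
      have h := ((hasDerivAt_id t).ofReal_comp.mul_const (b - a)).const_add a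
      rw [Complex.ofReal_one, one_mul] at h
      exact h.hasDerivWithinAt
    have hGγ := ((hG _ (hmaps ht)).comp t hγt hmaps).div_const (b - a)
    rw [mul_div_cancel_right₀ _ hd] at hGγ
    exact Complex.reCLM.hasFDerivAt.comp_hasDerivWithinAt t hGγ
  have hmono := strictMonoOn_of_hasDerivWithinAt_pos (convex_Icc (0 : ℝ) 1)
    (fun t ht => (hderiv ht).continuousWithinAt)
    (fun t ht => (hderiv (interior_subset ht)).mono interior_subset)
    (fun t ht => hpos _ (hmaps (interior_subset ht)))
  have hlt := hmono (left_mem_Icc.2 zero_le_one) (right_mem_Icc.2 zero_le_one) zero_lt_one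
  simp [hγ, hab] at hlt

/- In the logarithmic coordinate `z = exp ζ` on the left half-plane, the function becomes
`exp (ζ + L (exp ζ))`. -/
theorem injOn_id_mul_exp (hL : DifferentiableOn ℂ L unitDisk)
    (hre : ∀ z ∈ unitDisk, 0 < (1 + z * deriv L z).re) :
    InjOn (fun z => z * Complex.exp (L z)) unitDisk := by
  have hexp {ζ : ℂ} (hζ : ζ.re < 0) : Complex.exp ζ ∈ unitDisk := by
    rw [mem_unitDisk_iff, Complex.norm_exp]
    exact Real.exp_lt_one_iff.2 hζ
  have hinj : InjOn (fun ζ => ζ + L (Complex.exp ζ)) {ζ : ℂ | ζ.re < 0} := by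
    refine injOn_of_re_hasDerivWithinAt_pos (convex_halfSpace_re_lt 0) (fun ζ hζ => ?_)
      fun ζ hζ => hre _ (hexp hζ)
    have hLζ := (hL.differentiableAt (isOpen_unitDisk.mem_nhds (hexp hζ))).hasDerivAt.comp ζ
      (Complex.hasDerivAt_exp ζ)
    rw [mul_comm] at hLζ
    exact ((hasDerivAt_id ζ).add hLζ).hasDerivWithinAt
  have hlog {z : ℂ} (hz : z ∈ unitDisk) (hz0 : z ≠ 0) : (Complex.log z).re < 0 := by
    rw [Complex.log_re]
    exact Real.log_neg (norm_pos_iff.2 hz0) (mem_unitDisk_iff.1 hz)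
  intro a ha b hb hab
  by_cases h0 : a = 0 ∨ b = 0
  · rcases h0 with rfl | rfl <;> simpa [eq_comm] using hab
  obtain ⟨ha0, hb0⟩ := not_or.1 h0
  have hexp_eq : Complex.exp (Complex.log a + L a) = Complex.exp (Complex.log b + L b) := by
    simpa only [Complex.exp_add, Complex.exp_log ha0, Complex.exp_log hb0] using hab
  obtain ⟨n, hn⟩ := Complex.exp_eq_exp_iff_exists_int.1 hexp_eq
  set β : ℂ := Complex.log b + n * (2 * Real.pi * Complex.I) with hβ
  have hβb : Complex.exp β = b := by
    rw [hβ, Complex.exp_add, Complex.exp_int_mul_two_pi_mul_I, mul_one, Complex.exp_log hb0]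
  have hβre : β.re < 0 := by simpa [hβ] using hlog hb hb0
  have hlog_eq : Complex.log a = β := hinj (hlog ha ha0) hβre (by
    simp only [Complex.exp_log ha0, hβb]
    linear_combination hn)
  rw [← hβb, ← hlog_eq, Complex.exp_log ha0]

theorem injOn_of_mem_starlikeClass (hf : f ∈ starlikeClass) : InjOn f unitDisk := by
  obtain ⟨L, hL, -, hfL⟩ := exists_eq_mul_exp_of_mem_starlikeClass hf
  exact (injOn_id_mul_exp hL fun z hz => (hfL z hz).2 ▸ re_starlikeQuotient_pos hf hz).congr
    fun z hz => (hfL z hz).1.symm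

end Univalence

section KoebeQuarter

section OpenSet

variable {f : ℂ → ℂ} {U : Set ℂ}

theorem isOpen_image_of_deriv_ne_zero (hU : IsOpen U) (hf : DifferentiableOn ℂ f U)
    (hne : ∀ z ∈ U, deriv f z ≠ 0) : IsOpen (f '' U) := by
  refine isOpen_iff_mem_nhds.2 ?_
  rintro _ ⟨z, hz, rfl⟩
  rw [← (hf.analyticAt (hU.mem_nhds hz)).hasStrictDerivAt.map_nhds_eq (hne z hz)]
  exact Filter.image_mem_map (hU.mem_nhds hz)

theorem isOpenEmbedding_restrict_of_deriv_ne_zero (hU : IsOpen U) (hf : DifferentiableOn ℂ f U)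
    (hinj : InjOn f U) (hne : ∀ z ∈ U, deriv f z ≠ 0) :
    Topology.IsOpenEmbedding fun z : U => f z := by
  refine .of_continuous_injective_isOpenMap hf.continuousOn.domRestrict hinj.injective
    fun s hs => ?_
  have hsU : ((↑) '' s : Set ℂ) ⊆ U := Subtype.coe_image_subset U s
  have himage := isOpen_image_of_deriv_ne_zero (hU.isOpenMap_subtype_val s hs) (hf.mono hsU)
    fun z hz => hne z (hsU hz)
  rwa [image_image] at himage

/- An inverse of `f` defined on all of `ℂ` would be a bounded entire function. -/
theorem image_ne_univ_of_isBounded (hU : IsOpen U) (hUb : Bornology.IsBounded U)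
    (hf : DifferentiableOn ℂ f U) (hinj : InjOn f U) (hne : ∀ z ∈ U, deriv f z ≠ 0) :
    f '' U ≠ univ := by
  intro huniv
  choose g hgU hfg using fun y => (huniv ▸ mem_univ y : y ∈ f '' U)
  have hg : Differentiable ℂ g := fun y => by
    have hinv := (hf.analyticAt (hU.mem_nhds (hgU y))).hasStrictDerivAt.to_local_left_inverse
      (g := g) (hne _ (hgU y)) (by
        filter_upwards [hU.mem_nhds (hgU y)] with x hx using hinj (hgU _) hx (hfg _))
    rw [hfg] at hinv
    exact hinv.hasDerivAt.differentiableAt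
  have hconst : g 0 = g 1 :=
    hg.apply_eq_apply_of_bounded (hUb.subset (range_subset_iff.2 hgU)) 0 1
  exact zero_ne_one (by rw [← hfg 0, hconst, hfg])

end OpenSet

lemma frontier_image_subset_closure_image_diff {X Y : Type*} [TopologicalSpace X]
    [TopologicalSpace Y] [T2Space Y] {f : X → Y} {U C : Set X} (hC : IsCompact C) (hCU : C ⊆ U)
    (hf : ContinuousOn f C) (hfU : IsOpen (f '' U)) :
    frontier (f '' U) ⊆ closure (f '' (U \ C)) := by
  intro y hy
  rw [hfU.frontier_eq, ← sdiff_union_of_subset hCU, image_union, closure_union,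
    (hC.image_of_continuousOn hf).isClosed.closure_eq] at hy
  exact hy.1.resolve_right fun hyC => hy.2 (Or.inr hyC)

lemma monotoneOn_div_one_add_sq : MonotoneOn (fun x : ℝ => x / (1 + x) ^ 2) (Icc 0 1) := by
  intro a ha b hb hab
  have ha0 := ha.1
  have hb0 := hb.1
  have hprod : a * b ≤ 1 := mul_le_one₀ ha.2 hb0 hb.2
  simp only
  rw [div_le_div_iff₀ (by positivity) (by positivity)]
  linear_combination mul_nonneg (sub_nonneg.2 hab) (sub_nonneg.2 hprod)

theorem one_quarter_le_boundaryDist {f : ℂ → ℂ} (hf : f ∈ starlikeClass) :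
    1 / 4 ≤ boundaryDist f := by
  have hfd : DifferentiableOn ℂ f unitDisk := hf.1.1
  have hne : ∀ z ∈ unitDisk, deriv f z ≠ 0 := fun z hz => deriv_ne_zero_of_mem_starlikeClass hf hz
  have hfrontier : (frontier (f '' unitDisk)).Nonempty :=
    nonempty_frontier_iff.2 ⟨⟨f 0, mem_image_of_mem f zero_mem_unitDisk⟩,
      image_ne_univ_of_isBounded isOpen_unitDisk isBounded_ball hfd
        (injOn_of_mem_starlikeClass hf) hne⟩
  rw [boundaryDist, le_infDist hfrontier, hf.1.2.1]
  intro y hy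
  rw [dist_zero_left]
  have hle {ρ : ℝ} (hρ : ρ ∈ Ioo (0 : ℝ) 1) : ρ / (1 + ρ) ^ 2 ≤ ‖y‖ := by
    have hsub : closedBall (0 : ℂ) ρ ⊆ unitDisk := closedBall_subset_ball hρ.2
    have hclosed : IsClosed {w : ℂ | ρ / (1 + ρ) ^ 2 ≤ ‖w‖} :=
      isClosed_le continuous_const continuous_norm
    refine closure_minimal ?_ hclosed (frontier_image_subset_closure_image_diff
      (isCompact_closedBall 0 ρ) hsub (hfd.continuousOn.mono hsub)
      (isOpen_image_of_deriv_ne_zero isOpen_unitDisk hfd hne) hy)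
    rintro _ ⟨z, ⟨hz, hzρ⟩, rfl⟩
    rw [mem_closedBall_zero_iff, not_le] at hzρ
    exact (monotoneOn_div_one_add_sq (Ioo_subset_Icc_self hρ)
      ⟨norm_nonneg z, (mem_unitDisk_iff.1 hz).le⟩ hzρ.le).trans
      (div_one_add_sq_le_norm_of_mem_starlikeClass hf hz)
  have hlim : ContinuousAt (fun ρ : ℝ => ρ / (1 + ρ) ^ 2) 1 :=
    continuousAt_id.div (by fun_prop) (by norm_num)
  calc (1 / 4 : ℝ) = 1 / (1 + 1) ^ 2 := by norm_num
    _ ≤ ‖y‖ := by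
        refine le_of_tendsto (hlim.tendsto.mono_left (nhdsWithin_le_nhds (s := Iio 1))) ?_
        filter_upwards [Ioo_mem_nhdsLT zero_lt_one] with ρ hρ using hle hρ

end KoebeQuarter

section KoebeFunction

lemma koebe_zero : koebe 0 = 0 := by simp [koebe]

lemma hasDerivAt_koebe {z : ℂ} (hz : z ∈ unitDisk) :
    HasDerivAt koebe ((1 + z) / (1 - z) ^ 3) z := by
  have hz1 := one_sub_ne_zero_of_mem_unitDisk hz
  refine ((hasDerivAt_id' z).fun_div (((hasDerivAt_id' z).const_sub 1).fun_pow 2)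
    (pow_ne_zero 2 hz1)).congr_deriv ?_
  push_cast
  field_simp
  ring

lemma differentiableOn_koebe : DifferentiableOn ℂ koebe unitDisk := fun _ hz =>
  (hasDerivAt_koebe hz).differentiableAt.differentiableWithinAt

theorem koebe_mem_starlikeClass : koebe ∈ starlikeClass := by
  refine ⟨⟨differentiableOn_koebe, koebe_zero, ?_⟩, fun z hz hz0 => ?_, fun z => z,
    ⟨differentiableOn_id, mapsTo_id _, rfl⟩, fun z hz => ?_⟩
  · simp [(hasDerivAt_koebe zero_mem_unitDisk).deriv]
  · exact div_ne_zero hz0 (pow_ne_zero 2 (one_sub_ne_zero_of_mem_unitDisk hz))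
  · have hz1 := one_sub_ne_zero_of_mem_unitDisk hz
    rw [starlikeQuotient]
    split_ifs with hz0
    · simp [hz0]
    · rw [(hasDerivAt_koebe hz).deriv, koebe]
      field_simp

lemma taylorCoeff_inv_one_sub (n : ℕ) : taylorCoeff (fun z => (1 - z)⁻¹) n = 1 := by
  rw [taylorCoeff_eq_coeff (hasFPowerSeriesOnBall_inv_one_sub ℂ ℂ).hasFPowerSeriesAt]
  simp [formalMultilinearSeries_geometric_eq_ofScalars]

lemma dslope_koebe_zero :
    EqOn (dslope koebe 0) (deriv fun z => (1 - z)⁻¹) unitDisk := fun z hz => by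
  have hz1 := one_sub_ne_zero_of_mem_unitDisk hz
  have hderiv : deriv (fun z : ℂ => (1 - z)⁻¹) z = 1 / (1 - z) ^ 2 := by
    simpa using (((hasDerivAt_id' z).const_sub 1).fun_inv hz1).deriv
  rw [hderiv]
  rcases eq_or_ne z 0 with rfl | hz0
  · simp [(hasDerivAt_koebe zero_mem_unitDisk).deriv]
  · rw [dslope_of_ne _ hz0, slope_def_field, koebe_zero, koebe]
    field_simp
    ring

theorem taylorCoeff_koebe (n : ℕ) : taylorCoeff koebe n = n := by
  cases n with
  | zero => rw [taylorCoeff_zero, koebe_zero, Nat.cast_zero]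
  | succ n =>
    rw [← taylorCoeff_dslope (analyticAt_zero_of_differentiableOn differentiableOn_koebe),
      taylorCoeff_congr (eventuallyEq_zero_of_eqOn_unitDisk dslope_koebe_zero), taylorCoeff_deriv,
      taylorCoeff_inv_one_sub, mul_one, Nat.cast_succ]

lemma neg_one_div_four_mem_closure_image_koebe : (-1 / 4 : ℂ) ∈ closure (koebe '' unitDisk) := by
  have hcont : ContinuousAt koebe (-1) :=
    continuousAt_id.div (by fun_prop) (by norm_num)
  have hmem : (-1 : ℂ) ∈ closure unitDisk := by
    rw [unitDisk, closure_ball _ one_ne_zero, mem_closedBall_zero_iff, norm_neg, norm_one]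
  have hval : koebe (-1) = -1 / 4 := by norm_num [koebe]
  exact hval ▸ mem_closure_image hcont hmem

lemma neg_one_div_four_notMem_image_koebe : (-1 / 4 : ℂ) ∉ koebe '' unitDisk := by
  rintro ⟨z, hz, hval⟩
  have hz1 := one_sub_ne_zero_of_mem_unitDisk hz
  rw [koebe, div_eq_div_iff (pow_ne_zero 2 hz1) (by norm_num)] at hval
  have hsq : (1 + z) ^ 2 = 0 := by linear_combination hval
  have hz_eq : z = -1 := by linear_combination pow_eq_zero_iff two_ne_zero |>.1 hsq
  rw [hz_eq, mem_unitDisk_iff, norm_neg, norm_one] at hz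
  exact hz.false

theorem boundaryDist_koebe : boundaryDist koebe = 1 / 4 := by
  have hfrontier : (-1 / 4 : ℂ) ∈ frontier (koebe '' unitDisk) :=
    ⟨neg_one_div_four_mem_closure_image_koebe,
      fun h => neg_one_div_four_notMem_image_koebe (interior_subset h)⟩
  refine le_antisymm ((infDist_le_dist_of_mem hfrontier).trans_eq ?_)
    (one_quarter_le_boundaryDist koebe_mem_starlikeClass)
  rw [koebe_zero, dist_zero_left]
  norm_num

end KoebeFunction

section ExtremalMapping

/-- The affine map `z ↦ z + c * conj z` as a homeomorphism of the plane. It takes the analytic part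
of a harmonic mapping `f + conj g` with `g = conj c * f` to the mapping itself. -/
noncomputable def addConjHomeomorph (c : ℂ) (hc : ‖c‖ ≠ 1) : ℂ ≃ₜ ℂ :=
  have hdet : 1 - c * conj c ≠ 0 := by
    rw [Complex.mul_conj', sub_ne_zero, ne_comm]
    exact_mod_cast (pow_eq_one_iff_of_nonneg (norm_nonneg c) two_ne_zero).not.2 hc
  { toFun := fun z => z + c * conj z
    invFun := fun z => (z - c * conj z) / (1 - c * conj c)
    left_inv := fun z => by
      rw [div_eq_iff hdet]
      simp only [map_add, map_mul, Complex.conj_conj]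
      ring
    right_inv := fun z => by
      have : 1 - conj c * c ≠ 0 := by rwa [mul_comm]
      simp only [map_div₀, map_sub, map_mul, Complex.conj_conj, map_one]
      field_simp
      ring
    continuous_toFun := by fun_prop
    continuous_invFun := by fun_prop }

lemma dilatation_mem_Ico {K : ℝ} (hK : 1 ≤ K) : (K - 1) / (K + 1) ∈ Ico (0 : ℝ) 1 :=
  ⟨div_nonneg (by linarith) (by linarith), (div_lt_one (by linarith)).2 (by linarith)⟩

lemma isSensePreservingDilatationLE_koebe {K : ℝ} (hK : 1 ≤ K) :
    IsSensePreservingDilatationLE K koebe (scaledKoebe K) := by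
  obtain ⟨hk0, hk1⟩ := dilatation_mem_Ico hK
  have hderiv {z : ℂ} (hz : z ∈ unitDisk) :
      ‖deriv (scaledKoebe K) z‖ = (K - 1) / (K + 1) * ‖deriv koebe z‖ := by
    have hscaled : HasDerivAt (scaledKoebe K) _ z := (hasDerivAt_koebe hz).const_mul _
    rw [hscaled.deriv, norm_mul, Complex.norm_of_nonneg hk0, (hasDerivAt_koebe hz).deriv]
  refine ⟨differentiableOn_koebe, differentiableOn_koebe.const_mul _,
    by rw [scaledKoebe, koebe_zero, mul_zero], fun z hz => ?_, fun z hz => ?_⟩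
  · rw [hderiv hz]
    exact mul_lt_of_lt_one_left
      (norm_pos_iff.2 (deriv_ne_zero_of_mem_starlikeClass koebe_mem_starlikeClass hz)) hk1
  · rw [hderiv hz]
    refine le_of_eq ?_
    field_simp
    ring

theorem isQuasiconformalHarmonic_koebe {K : ℝ} (hK : 1 ≤ K) :
    IsQuasiconformalHarmonic K koebe (scaledKoebe K) := by
  obtain ⟨hk0, hk1⟩ := dilatation_mem_Ico hK
  refine ⟨isSensePreservingDilatationLE_koebe hK, ?_⟩
  have hkoebe : Topology.IsOpenEmbedding fun z : unitDisk => koebe z :=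
    isOpenEmbedding_restrict_of_deriv_ne_zero isOpen_unitDisk differentiableOn_koebe
      (injOn_of_mem_starlikeClass koebe_mem_starlikeClass)
      fun z hz => deriv_ne_zero_of_mem_starlikeClass koebe_mem_starlikeClass hz
  have hc : ‖(((K - 1) / (K + 1) : ℝ) : ℂ)‖ ≠ 1 := by
    rw [Complex.norm_of_nonneg hk0]
    exact hk1.ne
  convert (addConjHomeomorph _ hc).isOpenEmbedding.comp hkoebe using 1
  ext z
  simp [harmonicMap, scaledKoebe, addConjHomeomorph]

lemma isHarmonicSubordinate_koebe (K : ℝ) :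
    IsHarmonicSubordinate koebe (scaledKoebe K) koebe (scaledKoebe K) :=
  ⟨differentiableOn_koebe, differentiableOn_koebe.const_mul _,
    by rw [scaledKoebe, koebe_zero, mul_zero],
    fun z => z, ⟨differentiableOn_id, mapsTo_id _, rfl⟩, fun _ _ => rfl⟩

end ExtremalMapping

section BohrRadius

variable {K r : ℝ}

lemma hasSum_succ_mul_pow_succ (hr0 : 0 ≤ r) (hr1 : r < 1) :
    HasSum (fun n : ℕ => (n + 1) * r ^ (n + 1)) (r / (1 - r) ^ 2) := by
  have hsum := hasSum_coe_mul_geometric_of_norm_lt_one (by rwa [Real.norm_of_nonneg hr0])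
  rw [← hasSum_nat_add_iff' 1] at hsum
  simpa only [Finset.range_one, Finset.sum_singleton, Nat.cast_zero, zero_mul, sub_zero,
    Nat.cast_add, Nat.cast_one] using hsum

lemma strictMonoOn_div_one_sub_sq : StrictMonoOn (fun r : ℝ => r / (1 - r) ^ 2) (Ico 0 1) := by
  intro a ha b hb hab
  have hb1 : 0 < 1 - b := sub_pos.2 hb.2
  have hb0 : 0 < b := ha.1.trans_lt hab
  simp only
  gcongr

lemma bohrRadius_quadratic (hK : 0 ≤ K) :
    (K + 1) * (1 - bohrRadius K) ^ 2 = 8 * K * bohrRadius K := by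
  have hsqrt : √(8 * K * (3 * K + 1)) ^ 2 = 8 * K * (3 * K + 1) := Real.sq_sqrt (by positivity)
  have hK1 : K + 1 ≠ 0 := by positivity
  rw [bohrRadius]
  generalize √(8 * K * (3 * K + 1)) = s at hsqrt ⊢
  field_simp
  linear_combination hsqrt

lemma bohrRadius_pos (hK : 0 ≤ K) : 0 < bohrRadius K := by
  refine div_pos (sub_pos.2 ?_) (by positivity)
  rw [Real.sqrt_lt' (by positivity)]
  have hsq : 0 < (K + 1) ^ 2 := by positivity
  linear_combination hsq

lemma bohrRadius_lt_one_third (hK : 1 ≤ K) : bohrRadius K < 1 / 3 := by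
  rw [bohrRadius, div_lt_iff₀ (by positivity), sub_lt_comm]
  refine Real.lt_sqrt_of_sq_lt ?_
  nlinarith

lemma bohrRadius_mem_Ico (hK : 1 ≤ K) : bohrRadius K ∈ Ico (0 : ℝ) 1 :=
  ⟨(bohrRadius_pos (zero_le_one.trans hK)).le, (bohrRadius_lt_one_third hK).trans (by norm_num)⟩

lemma two_mul_div_mul_bohrRadius_eq (hK : 1 ≤ K) :
    2 * K / (K + 1) * (bohrRadius K / (1 - bohrRadius K) ^ 2) = 1 / 4 := by
  have hpos : 0 < 1 - bohrRadius K := sub_pos.2 (bohrRadius_mem_Ico hK).2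
  rw [div_mul_div_comm, div_eq_iff (by positivity)]
  linear_combination -bohrRadius_quadratic (zero_le_one.trans hK) / 4

theorem hasSum_bohrTerm_koebe (hK : 1 ≤ K) (hr0 : 0 ≤ r) (hr1 : r < 1) :
    HasSum (bohrTerm koebe (scaledKoebe K) r) (2 * K / (K + 1) * (r / (1 - r) ^ 2)) := by
  refine ((hasSum_succ_mul_pow_succ hr0 hr1).mul_left _).congr_fun fun n => ?_
  have hcoeff : taylorCoeff (scaledKoebe K) (n + 1) =
      (((K - 1) / (K + 1) : ℝ) : ℂ) * ((n + 1 : ℕ) : ℂ) := by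
    rw [← taylorCoeff_koebe]
    exact taylorCoeff_const_mul _ _ _
  rw [bohrTerm, hcoeff, taylorCoeff_koebe, norm_mul, Complex.norm_natCast,
    Complex.norm_of_nonneg (dilatation_mem_Ico hK).1]
  push_cast
  field_simp
  ring

lemma mul_majorantSum_dslope_le_of_mem_starlikeClass {f : ℂ → ℂ} (hf : f ∈ starlikeClass)
    (hr0 : 0 ≤ r) (hr1 : r < 1) (N : ℕ) :
    r * majorantSum (dslope f 0) r N ≤ r / (1 - r) ^ 2 := by
  refine le_trans ?_ (sum_le_hasSum (Finset.range N) (fun n _ => by positivity)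
    (hasSum_succ_mul_pow_succ hr0 hr1))
  rw [majorantSum, Finset.mul_sum]
  refine Finset.sum_le_sum fun n _ => ?_
  rw [taylorCoeff_dslope (analyticAt_zero_of_differentiableOn hf.1.1), mul_left_comm, ← pow_succ']
  gcongr
  exact norm_taylorCoeff_succ_le_of_mem_starlikeClass hf n

lemma IsSensePreservingDilatationLE.norm_deriv_div_le {f g : ℂ → ℂ}
    (h : IsSensePreservingDilatationLE K f g) {z : ℂ} (hz : z ∈ unitDisk) :
    ‖deriv g z / deriv f z‖ ≤ (K - 1) / (K + 1) := by
  have hlt := h.sense_preserving z hz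
  have hle := h.dilatation_le z hz
  have hf' : 0 < ‖deriv f z‖ := (norm_nonneg _).trans_lt hlt
  have hK : 0 < K :=
    pos_of_mul_pos_left ((add_pos_of_pos_of_nonneg hf' (norm_nonneg _)).trans_le hle)
      (sub_pos.2 hlt).le
  rw [norm_div, div_le_div_iff₀ hf' (by linarith)]
  linear_combination hle

theorem sum_bohrTerm_le_one_quarter {f g f₁ g₁ : ℂ → ℂ} (hK : 1 ≤ K)
    (hf : f ∈ starlikeClass) (h : IsSensePreservingDilatationLE K f g)
    (h₁ : IsHarmonicSubordinate f₁ g₁ f g) (hr : 0 ≤ r) (hrK : r ≤ bohrRadius K) (N : ℕ) :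
    ∑ n ∈ Finset.range N, bohrTerm f₁ g₁ r n ≤ 1 / 4 := by
  have hr3 : r ≤ 1 / 3 := hrK.trans (bohrRadius_lt_one_third hK).le
  have hr1 : r < 1 := hr3.trans_lt (by norm_num)
  have hf' : ∀ z ∈ unitDisk, deriv f z ≠ 0 := fun z hz =>
    deriv_ne_zero_of_mem_starlikeClass hf hz
  have hω : DifferentiableOn ℂ (fun z => deriv g z / deriv f z) unitDisk :=
    (h.analytic_right.deriv isOpen_unitDisk).div (h.analytic_left.deriv isOpen_unitDisk) hf'
  have hderiv : deriv g =ᶠ[nhds 0] fun z => deriv g z / deriv f z * deriv f z :=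
    eventuallyEq_zero_of_eqOn_unitDisk fun z hz => (div_mul_cancel₀ _ (hf' z hz)).symm
  have hk : 1 + (K - 1) / (K + 1) = 2 * K / (K + 1) := by
    field_simp
    ring
  calc ∑ n ∈ Finset.range N, bohrTerm f₁ g₁ r n
      ≤ (1 + (K - 1) / (K + 1)) * (r * majorantSum (dslope f 0) r N) :=
        h₁.sum_bohrTerm_le h.analytic_left h.analytic_right hω
          (fun _ hz => h.norm_deriv_div_le hz) hderiv hr hr3 N
    _ ≤ 2 * K / (K + 1) * (r / (1 - r) ^ 2) := by
        rw [hk]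
        gcongr
        exact mul_majorantSum_dslope_le_of_mem_starlikeClass hf hr hr1 N
    _ ≤ 2 * K / (K + 1) * (bohrRadius K / (1 - bohrRadius K) ^ 2) := by
        gcongr ?_ * ?_
        exact strictMonoOn_div_one_sub_sq.monotoneOn ⟨hr, hr1⟩ (bohrRadius_mem_Ico hK) hrK
    _ = 1 / 4 := two_mul_div_mul_bohrRadius_eq hK

theorem summable_bohrTerm_and_tsum_le_boundaryDist {f g f₁ g₁ : ℂ → ℂ} (hK : 1 ≤ K)
    (hf : f ∈ starlikeClass) (h : IsSensePreservingDilatationLE K f g)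
    (h₁ : IsHarmonicSubordinate f₁ g₁ f g) (hr : 0 ≤ r) (hrK : r ≤ bohrRadius K) :
    Summable (bohrTerm f₁ g₁ r) ∧ ∑' n, bohrTerm f₁ g₁ r n ≤ boundaryDist f := by
  have hnonneg (n : ℕ) : 0 ≤ bohrTerm f₁ g₁ r n := by
    rw [bohrTerm]
    positivity
  have hle := sum_bohrTerm_le_one_quarter hK hf h h₁ hr hrK
  exact ⟨summable_of_sum_range_le hnonneg hle,
    (Real.tsum_le_of_sum_range_le hnonneg hle).trans (one_quarter_le_boundaryDist hf)⟩

theorem tsum_bohrTerm_koebe_bohrRadius (hK : 1 ≤ K) :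
    ∑' n, bohrTerm koebe (scaledKoebe K) (bohrRadius K) n = boundaryDist koebe := by
  obtain ⟨hr0, hr1⟩ := bohrRadius_mem_Ico hK
  rw [(hasSum_bohrTerm_koebe hK hr0 hr1).tsum_eq, boundaryDist_koebe,
    two_mul_div_mul_bohrRadius_eq hK]

theorem boundaryDist_koebe_lt_tsum_bohrTerm (hK : 1 ≤ K) (hKr : bohrRadius K < r)
    (hr1 : r < 1) :
    boundaryDist koebe < ∑' n, bohrTerm koebe (scaledKoebe K) r n := by
  have hr0 : 0 ≤ r := (bohrRadius_mem_Ico hK).1.trans hKr.le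
  rw [(hasSum_bohrTerm_koebe hK hr0 hr1).tsum_eq, boundaryDist_koebe,
    ← two_mul_div_mul_bohrRadius_eq hK]
  gcongr ?_ * ?_
  exact strictMonoOn_div_one_sub_sq (bohrRadius_mem_Ico hK) ⟨hr0, hr1⟩ hKr

end BohrRadius

theorem mainTheorem4 (K : ℝ) (hK : 1 ≤ K) :
    (0 < bohrRadius K ∧ bohrRadius K < 1 / 3) ∧
    -- the Bohr inequality for all `r ≤ r₀`
    (∀ f g f₁ g₁ : ℂ → ℂ, f ∈ starlikeClass → IsSensePreservingDilatationLE K f g →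
      IsHarmonicSubordinate f₁ g₁ f g →
      ∀ r : ℝ, 0 ≤ r → r ≤ bohrRadius K →
        Summable (bohrTerm f₁ g₁ r) ∧ ∑' n, bohrTerm f₁ g₁ r n ≤ boundaryDist f) ∧
    -- sharpness: the extremal mapping `p = f₀ + k conj f₀`, with `f₀` the Koebe function
    (koebe ∈ starlikeClass ∧
      IsQuasiconformalHarmonic K koebe (scaledKoebe K) ∧
      IsHarmonicSubordinate koebe (scaledKoebe K) koebe (scaledKoebe K) ∧
      ∑' n, bohrTerm koebe (scaledKoebe K) (bohrRadius K) n = boundaryDist koebe ∧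
      ∀ r : ℝ, bohrRadius K < r → r < 1 →
        Summable (bohrTerm koebe (scaledKoebe K) r) ∧
          boundaryDist koebe < ∑' n, bohrTerm koebe (scaledKoebe K) r n) := by
  refine ⟨⟨bohrRadius_pos (zero_le_one.trans hK), bohrRadius_lt_one_third hK⟩,
    fun f g f₁ g₁ hf h h₁ r hr hrK =>
      summable_bohrTerm_and_tsum_le_boundaryDist hK hf h h₁ hr hrK,
    koebe_mem_starlikeClass, isQuasiconformalHarmonic_koebe hK, isHarmonicSubordinate_koebe K,
    tsum_bohrTerm_koebe_bohrRadius hK, fun r hKr hr1 => ?_⟩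
  exact ⟨(hasSum_bohrTerm_koebe hK ((bohrRadius_mem_Ico hK).1.trans hKr.le) hr1).summable,
    boundaryDist_koebe_lt_tsum_bohrTerm hK hKr hr1⟩
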